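/- Let $PM_2(\mathbb{C})=M_2(\mathbb{C})/\mathbb{C}^\times$ be the multiplicative monoid of complex $2\times 2$ matrices modulo non-zero scalars, with projection $\pi:M_2(\mathbb{C})\to PM_2(\mathbb{C})$, and regard $PGL_2(\mathbb{C})$ as the set of classes of invertible matrices in $PM_2(\mathbb{C})$. A subset $X\subseteq PM_2(\mathbb{C})$ is called definable if $\pi^{-1}(X)\subseteq M_2(\mathbb{C})=\mathbb{C}^4$ is definable, with parameters from $\mathbb{C}$, in the first-order language of rings; it is called $\infty$-definable if it is an intersection of fewer than $2^{\aleph_0}$ definable sets. A definable monoid is a submonoid of $PM_2(\mathbb{C})$ that is a definable set. Let $M=H\cup S$ be a submonoid of $PM_2(\mathbb{C})$, where $H=M\cap PGL_2(\mathbb{C})$ is its regular part and $S=M\setminus H$ is its singular part, and assume that $H$ is an algebraic (i.e. Zariski closed) subgroup of $PGL_2(\mathbb{C})$. 1. Assume that at least one of the following holds: $0\in M$; or the rank-one elements of $M$ have, altogether, only finitely many images (as lines in $\mathbb{C}^2$); or they have, altogether, only finitely many kernels; or $M$ is $\infty$-definable. Then $M$ is an intersection of definable monoids. 2. If $H$ is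 infinite, then (without any further assumption) $M$ itself is definable, and every $H$-invariant subset of $\mathbb{C}P^1$ is finite or cofinite. -/

import Mathlib

open scoped MatrixGroups Cardinal LinearAlgebra.Projectivization

noncomputable section

/-- The congruence on the multiplicative monoid `M₂(ℂ)` that identifies `A` with `c • A`
for all `c ∈ ℂˣ`. -/
def scalarCon : Con (Matrix (Fin 2) (Fin 2) ℂ) where
  r A B := ∃ c : ℂˣ, B = (c : ℂ) • A
  iseqv :=
    { refl := fun A => ⟨1, by simp⟩
      symm := by
        rintro A B ⟨c, rfl⟩
        exact ⟨c⁻¹, by simp [smul_smul]⟩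
      trans := by
        rintro A B C ⟨c, rfl⟩ ⟨d, rfl⟩
        exact ⟨d * c, by simp [smul_smul]⟩ }
  mul' := by
    rintro A B C D ⟨c, rfl⟩ ⟨d, rfl⟩
    exact ⟨c * d, by simp [smul_smul, mul_comm]⟩

/-- The monoid `PM₂(ℂ) = M₂(ℂ) / ℂˣ`. -/
abbrev PM2 : Type := scalarCon.Quotient

namespace PM2

/-- The natural surjective homomorphism `π : M₂(ℂ) → PM₂(ℂ)`. -/
def proj : Matrix (Fin 2) (Fin 2) ℂ →* PM2 := scalarCon.mk'

/-- A subset `X` of `PM₂(ℂ)` is definable if its preimage in `M₂(ℂ) = ℂ⁴` is defined by a first-order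
formula in the language of rings with parameters from `ℂ` (as usual for a quotient by a definable
equivalence relation). -/
def Definable (X : Set PM2) : Prop :=
  letI : FirstOrder.Ring.CompatibleRing ℂ := FirstOrder.Ring.compatibleRingOfRing ℂ
  (Set.univ : Set ℂ).Definable FirstOrder.Language.ring
    {x : Fin 2 × Fin 2 → ℂ | proj (Matrix.of fun i j => x (i, j)) ∈ X}

/-- A submonoid of `PM₂(ℂ)` is a definable monoid if its underlying set is definable. Its operation is
then definable as well, being the restriction of the multiplication of `PM₂(ℂ)`, whose graph
is definable: `π(A) π(B) = π(C)` if and only if `C = c A B` for some `c ≠ 0`. -/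
def IsDefinableMonoid (N : Submonoid PM2) : Prop :=
  Definable (N : Set PM2)

/-- A subset of `PM₂(ℂ)` is `∞`-definable if it is the intersection of a small family of definable
sets. As usual, small means of cardinality less than that of the (saturated) model `ℂ`. -/
def InfDefinable (X : Set PM2) : Prop :=
  ∃ 𝒟 : Set (Set PM2), #𝒟 < 𝔠 ∧ (∀ D ∈ 𝒟, Definable D) ∧ X = ⋂₀ 𝒟

/-- `M` is the intersection of a family of definable submonoids of `PM₂(ℂ)`. -/
def IsInterOfDefinableMonoids (M : Submonoid PM2) : Prop :=
  ∃ 𝒩 : Set (Submonoid PM2), (∀ N ∈ 𝒩, IsDefinableMonoid N) ∧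
    (M : Set PM2) = ⋂ N ∈ 𝒩, (N : Set PM2)

/-- `H` is the regular part `M ∩ PGL₂(ℂ)` of the submonoid `M` of `PM₂(ℂ)`. -/
def IsRegularPart (M : Submonoid PM2) (H : Subgroup PGL(2, ℂ)) : Prop :=
  ∀ g : GL (Fin 2) ℂ,
    Matrix.ProjGenLinGroup.mk g ∈ H ↔ proj (g : Matrix (Fin 2) (Fin 2) ℂ) ∈ M

/-- A subgroup of `PGL₂(ℂ)` is algebraic if it is Zariski closed, that is, if its preimage in
`GL₂(ℂ)` is the set of common zeros in `GL₂(ℂ)` of a set of polynomials in the matrix entries. -/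
def IsAlgebraicSubgroup (H : Subgroup PGL(2, ℂ)) : Prop :=
  ∃ P : Set (MvPolynomial (Fin 2 × Fin 2) ℂ), ∀ g : GL (Fin 2) ℂ,
    Matrix.ProjGenLinGroup.mk g ∈ H ↔
      ∀ p ∈ P, MvPolynomial.eval
        (fun ij : Fin 2 × Fin 2 => (g : Matrix (Fin 2) (Fin 2) ℂ) ij.1 ij.2) p = 0

/-- The lines in `ℂ²` that are the image of some rank-one element of `M`. -/
def imageLines (M : Submonoid PM2) : Set (Submodule ℂ (Fin 2 → ℂ)) :=
  {L | ∃ A : Matrix (Fin 2) (Fin 2) ℂ, A.rank = 1 ∧ proj A ∈ M ∧ L = LinearMap.range A.mulVecLin}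

/-- The lines in `ℂ²` that are the kernel of some rank-one element of `M`. -/
def kernelLines (M : Submonoid PM2) : Set (Submodule ℂ (Fin 2 → ℂ)) :=
  {L | ∃ A : Matrix (Fin 2) (Fin 2) ℂ, A.rank = 1 ∧ proj A ∈ M ∧ L = LinearMap.ker A.mulVecLin}

end PM2

end

/-! Besides `reg` of PGL₂ and zero, PM₂ consists of the elements `rankOne a b`, indexed by an image
`a` and a kernel `b` in ℂP¹. The product of (a, b) and (c, d) is (a, d) if c ≠ b and zero otherwise,
and H acts on both coordinates. So everything reduces to H-invariant subsets of the line, where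
definable sets are finite or cofinite (`LineDefinable.finite_or_finite_compl`) and H-orbits are
definable (`lineDefinable_orbit`).

For the first claim, each x outside M is separated from M by a definable monoid containing M. If
zero lies in M, a missing pair (p, q) is excluded by deleting the orbit of p from the images or of q
from the kernels; when p is an image and q a kernel, M is confined to pairs having a fixed point of
H as image or kernel. If zero is not in M, the rank-one part is a product I × K with I and K
disjoint, and it suffices to enclose I and K in disjoint definable invariant sets. This is easy when
one of them is finite. An ∞-definable M has that property: otherwise I and K would both have
complements of size less than 𝔠, and these complements cover the line.

For the second claim, an infinite H has an infinite orbit, which is then cofinite. Hence there are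
finitely many orbits, and the rank-one part of M is a finite union of products of orbits. -/

/-! ### Minimality of algebraically closed fields -/

/-- Any two transcendental elements of an algebraically closed extension are conjugate. -/
theorem IsAlgClosed.exists_ringEquiv_apply_eq_of_transcendental {K L : Type*} [Field K] [Field L]
    [Algebra K L] [IsAlgClosed L] {s t : L} (hs : Transcendental K s) (ht : Transcendental K t) :
    ∃ σ : L ≃+* L, (∀ a : K, σ (algebraMap K L a) = algebraMap K L a) ∧ σ s = t := by
  classical
  have key : ∀ {s : L}, Transcendental K s →
      ∃ B : Set L, s ∈ B ∧ IsTranscendenceBasis K ((↑) : B → L) := by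
    intro s hs
    obtain ⟨B, hB, hB'⟩ := exists_isTranscendenceBasis_superset (R := K) (s := {s})
      ((algebraicIndependent_unique_type_iff).2 (by simpa using! hs))
    exact ⟨B, hB rfl, hB'⟩
  obtain ⟨B, hsB, hB⟩ := key hs
  obtain ⟨C, htC, hC⟩ := key ht
  obtain ⟨e₀⟩ := Cardinal.eq.1 (hB.cardinalMk_eq_trdeg.trans hC.cardinalMk_eq_trdeg.symm)
  -- The transposition corrects an arbitrary bijection of the bases so that it sends `s` to `t`.
  let e : B ≃ C := e₀.trans (Equiv.swap (e₀ ⟨s, hsB⟩) ⟨t, htC⟩)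
  have he : e ⟨s, hsB⟩ = ⟨t, htC⟩ := by simp [e]
  let f : Algebra.adjoin K (Set.range ((↑) : B → L)) ≃ₐ[K]
      Algebra.adjoin K (Set.range ((↑) : C → L)) :=
    hB.1.aevalEquiv.symm.trans ((MvPolynomial.renameEquiv K e).trans hC.1.aevalEquiv)
  let s' := hB.1.aevalEquiv (MvPolynomial.X ⟨s, hsB⟩)
  have hs' : algebraMap _ L s' = s := by simp [s']
  have hf : algebraMap _ L (f s') = t := by simp [f, s', he]
  let := IsAlgClosed.isAlgClosure_of_transcendence_basis _ hB
  let := IsAlgClosed.isAlgClosure_of_transcendence_basis _ hC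
  refine ⟨IsAlgClosure.equivOfEquiv L L f.toRingEquiv, fun a => ?_, ?_⟩
  · rw [IsScalarTower.algebraMap_apply K (Algebra.adjoin K (Set.range ((↑) : B → L))) L,
      IsAlgClosure.equivOfEquiv_algebraMap]
    change algebraMap _ L (f _) = _
    rw [f.commutes, ← IsScalarTower.algebraMap_apply, ← IsScalarTower.algebraMap_apply]
  · conv_lhs => rw [← hs', IsAlgClosure.equivOfEquiv_algebraMap]
    exact hf

open FirstOrder FirstOrder.Ring Filter in
/-- Algebraically closed fields are minimal structures. -/
theorem IsAlgClosed.finite_or_finite_compl_of_definable {K : Type*} [Field K] [IsAlgClosed K]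
    [CompatibleRing K] {S : Set K} (hS : (Set.univ : Set K).Definable₁ Language.ring S) :
    S.Finite ∨ Sᶜ.Finite := by
  by_contra! ⟨h1, h2⟩
  obtain ⟨φ, hφ⟩ := Set.definable_iff_exists_formula_sum.1 hS
  have hφ' : ∀ x, x ∈ S ↔
      φ.Realize (Sum.elim (fun i : (Set.univ : Set K) => (i : K)) (fun _ : Fin 1 => x)) :=
    fun x => iff_of_eq congr((fun _ : Fin 1 => x) ∈ $hφ)
  -- In an ultrapower, injective sequences in `S` and in `Sᶜ` become transcendental over `K`. An
  -- automorphism over `K` carries one class to the other, which Łoś's theorem forbids.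
  let U : Ultrafilter ℕ := hyperfilter ℕ
  let L := (U : Filter ℕ).Product fun _ => K
  obtain ⟨p, hp⟩ := CharP.exists K
  have : (Language.Theory.ACF p).Model L := by
    refine Language.Theory.model_iff _ |>.2 fun ψ hψ => ?_
    exact (Language.Ultraproduct.sentence_realize ψ).2
      (.of_forall fun _ => (Language.Theory.ACF p).realize_sentence_of_mem hψ)
  let : Field L := Field.fieldOfModelACF p L
  have := Field.modelField_of_modelACF p L
  let : CompatibleRing L := Field.compatibleRingOfModelField L
  have : IsAlgClosed L := Field.isAlgClosed_of_model_ACF p L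
  let c : (ℕ → K) → L := fun x => (x : L)
  have c_funMap : ∀ {n} (f : Language.ring.Functions n) (x : Fin n → ℕ → K),
      (Language.Structure.funMap f fun i => c (x i)) =
        c fun a => Language.Structure.funMap f fun i => x i a :=
    fun f x => Language.Ultraproduct.funMap_cast f x
  let ι : K →+* L :=
    { toFun := fun a => c fun _ => a
      map_one' := by
        have h := c_funMap oneFunc (fun i : Fin 0 => i.elim0)
        rw [CompatibleRing.funMap_one] at h
        simpa using h.symm
      map_zero' := by
        have h := c_funMap zeroFunc (fun i : Fin 0 => i.elim0)
        rw [CompatibleRing.funMap_zero] at h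
        simpa using h.symm
      map_mul' := fun a b => by
        have h := c_funMap mulFunc ![fun _ => a, fun _ => b]
        rw [CompatibleRing.funMap_mul] at h
        simpa using h.symm
      map_add' := fun a b => by
        have h := c_funMap addFunc ![fun _ => a, fun _ => b]
        rw [CompatibleRing.funMap_add] at h
        simpa using h.symm }
  let _ : Algebra K L := ι.toAlgebra
  have transc : ∀ x : ℕ → K, x.Injective → Transcendental K (c x) := by
    intro x hx halg
    have := IntermediateField.isAlgebraic_adjoin_simple halg.isIntegral
    -- An algebraic class would lie in `K`, so the sequence would be constant on a set of the
    -- ultrafilter; injectivity leaves at most one index, and the ultrafilter is non-principal.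
    have hbot := IntermediateField.eq_bot_of_isAlgClosed_of_isAlgebraic
      (IntermediateField.adjoin K {c x})
    obtain ⟨a, ha⟩ := IntermediateField.mem_bot.1
      (hbot ▸ IntermediateField.mem_adjoin_simple_self K (c x))
    have h : ∀ᶠ n in (U : Filter ℕ), a = x n := Quotient.exact ha
    have hfin : {n | a = x n}.Finite := Set.Subsingleton.finite
      fun m hm n hn => hx (hm.symm.trans hn)
    exact notMem_hyperfilter_of_finite hfin h
  let d := h1.natEmbedding
  let e := h2.natEmbedding
  obtain ⟨σ, hσK, hσ⟩ := IsAlgClosed.exists_ringEquiv_apply_eq_of_transcendental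
    (transc (fun n => (d n : K)) (Subtype.val_injective.comp d.injective))
    (transc (fun n => (e n : K)) (Subtype.val_injective.comp e.injective))
  have los : ∀ x : ℕ → K, φ.Realize (Sum.elim
      (fun i : (Set.univ : Set K) => algebraMap K L (i : K)) (fun _ : Fin 1 => c x)) ↔
      ∀ᶠ n in (U : Filter ℕ), x n ∈ S := by
    intro x
    simp only [hφ']
    have h := Language.Ultraproduct.realize_formula_cast (u := U) (M := fun _ => K) φ
      (Sum.elim (fun i _ => (i : K)) (fun _ => x))
    have hL : (Sum.elim (fun i : (Set.univ : Set K) => algebraMap K L (i : K))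
        (fun _ : Fin 1 => c x)) = fun i => c (Sum.elim
          (fun (i : (Set.univ : Set K)) (_ : ℕ) => (i : K)) (fun _ : Fin 1 => x) i) := by
      funext i
      rcases i with i | i <;> rfl
    have hK : ∀ n, (Sum.elim (fun i : (Set.univ : Set K) => (i : K)) (fun _ : Fin 1 => x n)) =
        fun i => Sum.elim (fun (i : (Set.univ : Set K)) (_ : ℕ) => (i : K))
          (fun _ : Fin 1 => x) i n := by
      intro n
      funext i
      rcases i with i | i <;> rfl
    simp only [hK]
    rw [hL]
    exact h
  have hd := (los fun n => (d n : K)).2 (.of_forall fun n => (d n).2)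
  rw [← Language.StrongHomClass.realize_formula ((languageEquivEquivRingEquiv).symm σ)] at hd
  have he : φ.Realize (Sum.elim
      (fun i : (Set.univ : Set K) => algebraMap K L (i : K))
      (fun _ : Fin 1 => c fun n => (e n : K))) := by
    convert hd using 1
    ext i
    rcases i with i | i
    · exact (hσK i).symm
    · exact hσ.symm
  obtain ⟨n, hn⟩ := ((los _).1 he).exists
  exact (e n).2 hn

/-! ### Regular, zero and rank-one elements, and their products -/

namespace PM2

theorem proj_eq_proj_iff {A B : Matrix (Fin 2) (Fin 2) ℂ} :
    proj A = proj B ↔ ∃ c : ℂˣ, B = (c : ℂ) • A :=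
  scalarCon.eq

theorem proj_surjective : Function.Surjective proj := Con.mk'_surjective

theorem proj_smul {c : ℂ} (hc : c ≠ 0) (A : Matrix (Fin 2) (Fin 2) ℂ) : proj (c • A) = proj A :=
  (proj_eq_proj_iff.2 ⟨Units.mk0 c hc, rfl⟩).symm

/-- The inclusion of `PGL₂(ℂ)` in `PM₂(ℂ)`. -/
noncomputable def reg : PGL(2, ℂ) →* PM2 :=
  Matrix.ProjGenLinGroup.lift (proj.comp (Units.coeHom _)) <| by
    ext u
    refine proj_eq_proj_iff.2 ⟨u⁻¹, ?_⟩
    ext i j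
    simp [Matrix.one_apply, Matrix.diagonal_apply]

@[simp]
theorem reg_mk (g : GL (Fin 2) ℂ) : reg (Matrix.ProjGenLinGroup.mk g) = proj g.val := rfl

theorem reg_mk_mkOfDetNeZero (A : Matrix (Fin 2) (Fin 2) ℂ) (hA : A.det ≠ 0) :
    reg (.mk (.mkOfDetNeZero A hA)) = proj A := rfl

theorem reg_injective : Function.Injective reg := by
  intro g h
  induction g using Matrix.ProjGenLinGroup.induction_on with | mk g =>
  induction h using Matrix.ProjGenLinGroup.induction_on with | mk h =>
  intro hgh
  obtain ⟨c, hc⟩ := proj_eq_proj_iff.1 hgh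
  refine Matrix.ProjGenLinGroup.mk_eq_mk_iff.2 ⟨c, Units.ext ?_⟩
  refine Eq.trans ?_ hc.symm
  ext i j
  simp [mul_comm]

/-- For non-zero `u` and `w`, a matrix with image `ℂ u` and kernel `ℂ w`. -/
def rankOneMatrix (u w : Fin 2 → ℂ) : Matrix (Fin 2) (Fin 2) ℂ :=
  Matrix.vecMulVec u ![w 1, -w 0]

theorem rankOneMatrix_mulVec (u w v : Fin 2 → ℂ) :
    (rankOneMatrix u w).mulVec v = (w 1 * v 0 - w 0 * v 1) • u := by
  ext i
  simp [rankOneMatrix, Matrix.mulVec, Matrix.vecMulVec_apply, dotProduct, Fin.sum_univ_two]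
  ring

theorem rankOneMatrix_mul_rankOneMatrix (u w u' w' : Fin 2 → ℂ) :
    rankOneMatrix u w * rankOneMatrix u' w' =
      (w 1 * u' 0 - w 0 * u' 1) • rankOneMatrix u w' := by
  ext i j
  fin_cases j <;> simp [rankOneMatrix, Matrix.mul_apply, Fin.sum_univ_two] <;> ring

theorem mul_rankOneMatrix (A : Matrix (Fin 2) (Fin 2) ℂ) (u w : Fin 2 → ℂ) :
    A * rankOneMatrix u w = rankOneMatrix (A.mulVec u) w := by
  rw [rankOneMatrix, Matrix.mul_vecMulVec, rankOneMatrix]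

/-- The functional attached to `w` is v ↦ det(v, w), and det(Av, Aw) = det A · det(v, w). -/
theorem rankOneMatrix_mulVec_mul (A : Matrix (Fin 2) (Fin 2) ℂ) (u w : Fin 2 → ℂ) :
    rankOneMatrix u (A.mulVec w) * A = A.det • rankOneMatrix u w := by
  ext i j
  fin_cases j <;>
  simp [rankOneMatrix, Matrix.mul_apply, Fin.sum_univ_two, Matrix.mulVec, dotProduct,
    Matrix.det_fin_two] <;>
  ring

theorem rankOneMatrix_smul_smul (c d : ℂ) (u w : Fin 2 → ℂ) :
    rankOneMatrix (c • u) (d • w) = (c * d) • rankOneMatrix u w := by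
  ext i j
  fin_cases j <;> simp [rankOneMatrix, Matrix.vecMulVec_apply] <;> ring

theorem cross_eq_zero_iff {u w : Fin 2 → ℂ} (hu : u ≠ 0) (hw : w ≠ 0) :
    w 1 * u 0 - w 0 * u 1 = 0 ↔
      Projectivization.mk ℂ u hu = Projectivization.mk ℂ w hw := by
  rw [Projectivization.mk_eq_mk_iff']
  constructor
  · intro h
    by_cases h0 : w 0 = 0
    · have h1 : w 1 ≠ 0 := fun h1 => hw (by ext i; fin_cases i <;> simp [h0, h1])
      refine ⟨u 1 / w 1, ?_⟩
      have : u 0 = 0 := by simpa [h0, h1] using h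
      ext i; fin_cases i <;> simp [h0, h1, this]
    · refine ⟨u 0 / w 0, ?_⟩
      ext i; fin_cases i
      · simp [h0]
      · simp; field_simp; linear_combination h
  · rintro ⟨a, rfl⟩
    simp; ring

theorem ker_rankOneMatrix {u w : Fin 2 → ℂ} (hu : u ≠ 0) (hw : w ≠ 0) :
    LinearMap.ker (rankOneMatrix u w).mulVecLin = Submodule.span ℂ {w} := by
  ext v
  rw [LinearMap.mem_ker, Matrix.mulVecLin_apply, rankOneMatrix_mulVec, smul_eq_zero,
    or_iff_left hu, Submodule.mem_span_singleton]
  by_cases hv : v = 0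
  · subst hv
    simp
  · rw [cross_eq_zero_iff hv hw, Projectivization.mk_eq_mk_iff']

theorem range_rankOneMatrix {u w : Fin 2 → ℂ} (hw : w ≠ 0) :
    LinearMap.range (rankOneMatrix u w).mulVecLin = Submodule.span ℂ {u} := by
  ext v
  simp only [LinearMap.mem_range, Matrix.mulVecLin_apply, rankOneMatrix_mulVec,
    Submodule.mem_span_singleton]
  constructor
  · rintro ⟨y, rfl⟩
    exact ⟨_, rfl⟩
  · rintro ⟨a, rfl⟩
    by_cases h0 : w 0 = 0
    · have h1 : w 1 ≠ 0 := fun h1 => hw (by ext i; fin_cases i <;> simp [h0, h1])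
      exact ⟨![a / w 1, 0], by simp [h1, mul_div_cancel₀]⟩
    · exact ⟨![0, -a / w 0], by simp [h0, mul_div_cancel₀]⟩

theorem rankOneMatrix_ne_zero {u w : Fin 2 → ℂ} (hu : u ≠ 0) (hw : w ≠ 0) :
    rankOneMatrix u w ≠ 0 := by
  intro h
  have := range_rankOneMatrix (u := u) hw
  rw [h, Matrix.mulVecLin_zero, LinearMap.range_zero, eq_comm, Submodule.span_singleton_eq_bot]
    at this
  exact hu this

theorem det_rankOneMatrix (u w : Fin 2 → ℂ) : (rankOneMatrix u w).det = 0 := by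
  simp [rankOneMatrix, Matrix.det_fin_two]; ring

theorem rank_rankOneMatrix {u w : Fin 2 → ℂ} (hu : u ≠ 0) (hw : w ≠ 0) :
    (rankOneMatrix u w).rank = 1 := by
  rw [Matrix.rank, range_rankOneMatrix hw, finrank_span_singleton hu]

theorem exists_eq_rankOneMatrix {A : Matrix (Fin 2) (Fin 2) ℂ} (hA : A ≠ 0) (hdet : A.det = 0) :
    ∃ u w : Fin 2 → ℂ, u ≠ 0 ∧ w ≠ 0 ∧ A = rankOneMatrix u w := by
  rw [Matrix.det_fin_two] at hdet
  have key : ∃ u v : Fin 2 → ℂ, A = Matrix.vecMulVec u v := by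
    by_cases h0 : A 0 0 = 0
    · by_cases h1 : A 1 0 = 0
      · refine ⟨![A 0 1, A 1 1], ![0, 1], ?_⟩
        ext i j; fin_cases i <;> fin_cases j <;> simp [Matrix.vecMulVec_apply, h0, h1]
      · refine ⟨![A 0 0, A 1 0], ![1, A 1 1 / A 1 0], ?_⟩
        have h2 : A 0 1 = 0 := by simpa [h0, h1] using hdet
        ext i j; fin_cases i <;> fin_cases j <;>
          simp [Matrix.vecMulVec_apply, h0, h1, h2, mul_div_cancel₀]
    · refine ⟨![A 0 0, A 1 0], ![1, A 0 1 / A 0 0], ?_⟩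
      ext i j; fin_cases i <;> fin_cases j <;>
        simp [Matrix.vecMulVec_apply, h0, mul_div_cancel₀]
      field_simp; linear_combination hdet
  obtain ⟨u, v, rfl⟩ := key
  -- This vector spans the kernel of the functional `v`; it inverts w ↦ (w 1, -w 0).
  refine ⟨u, ![-v 1, v 0], ?_, ?_, ?_⟩
  · rintro rfl
    exact hA (by simp)
  · intro h
    have h0 := congrFun h 0
    have h1 := congrFun h 1
    simp at h0 h1
    exact hA (by ext i j; fin_cases j <;> simp [Matrix.vecMulVec_apply, h0, h1])
  · ext i j; fin_cases j <;> simp [rankOneMatrix, Matrix.vecMulVec_apply]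

/-- The rank-one element of `PM₂(ℂ)` with image `a` and kernel `b`. -/
noncomputable def rankOne (a b : ℙ ℂ (Fin 2 → ℂ)) : PM2 := proj (rankOneMatrix a.rep b.rep)

theorem proj_rankOneMatrix {u w : Fin 2 → ℂ} (hu : u ≠ 0) (hw : w ≠ 0) :
    proj (rankOneMatrix u w) = rankOne (.mk ℂ u hu) (.mk ℂ w hw) := by
  obtain ⟨c, hc⟩ := Projectivization.exists_smul_eq_mk_rep ℂ u hu
  obtain ⟨d, hd⟩ := Projectivization.exists_smul_eq_mk_rep ℂ w hw
  rw [rankOne, ← hc, ← hd]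
  simp only [Units.smul_def, rankOneMatrix_smul_smul]
  rw [proj_smul (mul_ne_zero c.ne_zero d.ne_zero)]

theorem rankOne_injective2 : Function.Injective2 rankOne := by
  intro a a' b b' h
  obtain ⟨c, hc⟩ := proj_eq_proj_iff.1 h
  have hr := range_rankOneMatrix (u := a'.rep) b'.rep_nonzero
  have hk := ker_rankOneMatrix a'.rep_nonzero b'.rep_nonzero
  have hl : ((c : ℂ) • rankOneMatrix a.rep b.rep).mulVecLin =
      (c : ℂ) • (rankOneMatrix a.rep b.rep).mulVecLin := by
    ext; simp
  rw [hc, hl, LinearMap.range_smul _ _ c.ne_zero, range_rankOneMatrix b.rep_nonzero] at hr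
  rw [hc, hl, LinearMap.ker_smul _ _ c.ne_zero,
    ker_rankOneMatrix a.rep_nonzero b.rep_nonzero] at hk
  rw [← Projectivization.submodule_eq, ← Projectivization.submodule_eq] at hr hk
  exact ⟨Projectivization.submodule_injective hr, Projectivization.submodule_injective hk⟩

theorem rankOne_ne_proj_zero (a b : ℙ ℂ (Fin 2 → ℂ)) : rankOne a b ≠ proj 0 := by
  intro h
  obtain ⟨c, hc⟩ := proj_eq_proj_iff.1 h.symm
  exact rankOneMatrix_ne_zero a.rep_nonzero b.rep_nonzero (by simpa using hc)

theorem proj_ne_reg {A : Matrix (Fin 2) (Fin 2) ℂ} (hA : A.det = 0) (h : PGL(2, ℂ)) :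
    proj A ≠ reg h := by
  induction h using Matrix.ProjGenLinGroup.induction_on with | mk h =>
  intro he
  obtain ⟨c, hc⟩ := proj_eq_proj_iff.1 he
  refine h.det_ne_zero ?_
  change Matrix.det (Units.coeHom _ h) = 0
  rw [hc, Matrix.det_smul, hA, mul_zero]

theorem rankOne_ne_reg (a b : ℙ ℂ (Fin 2 → ℂ)) (h : PGL(2, ℂ)) : rankOne a b ≠ reg h :=
  proj_ne_reg (det_rankOneMatrix _ _) h

theorem proj_zero_ne_reg (h : PGL(2, ℂ)) : proj 0 ≠ reg h :=
  proj_ne_reg (by simp) h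

theorem eq_reg_or_eq_zero_or_eq_rankOne (x : PM2) :
    (∃ h, x = reg h) ∨ x = proj 0 ∨ ∃ a b, x = rankOne a b := by
  obtain ⟨A, rfl⟩ := proj_surjective x
  by_cases hdet : A.det = 0
  · by_cases hA : A = 0
    · exact .inr (.inl (by rw [hA]))
    · obtain ⟨u, w, hu, hw, rfl⟩ := exists_eq_rankOneMatrix hA hdet
      exact .inr (.inr ⟨_, _, proj_rankOneMatrix hu hw⟩)
  · exact .inl ⟨.mk (.mkOfDetNeZero A hdet), rfl⟩

theorem proj_zero_mul (x : PM2) : proj 0 * x = proj 0 := by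
  obtain ⟨A, rfl⟩ := proj_surjective x
  rw [← map_mul, zero_mul]

theorem mul_proj_zero (x : PM2) : x * proj 0 = proj 0 := by
  obtain ⟨A, rfl⟩ := proj_surjective x
  rw [← map_mul, mul_zero]

theorem reg_mul_rankOne (h : PGL(2, ℂ)) (a b : ℙ ℂ (Fin 2 → ℂ)) :
    reg h * rankOne a b = rankOne (h • a) b := by
  induction h using Matrix.ProjGenLinGroup.induction_on with | mk h =>
  induction a using Projectivization.ind with | _ u hu =>
  induction b using Projectivization.ind with | _ w hw =>
  rw [reg_mk, ← proj_rankOneMatrix, ← map_mul, mul_rankOneMatrix,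
    Projectivization.PGL.mk_smul_mk, ← proj_rankOneMatrix]
  rfl

theorem rankOne_smul_mul_reg (h : PGL(2, ℂ)) (a b : ℙ ℂ (Fin 2 → ℂ)) :
    rankOne a (h • b) * reg h = rankOne a b := by
  induction h using Matrix.ProjGenLinGroup.induction_on with | mk h =>
  induction a using Projectivization.ind with | _ u hu =>
  induction b using Projectivization.ind with | _ w hw =>
  rw [Projectivization.PGL.mk_smul_mk, reg_mk, ← proj_rankOneMatrix, ← map_mul]
  change proj (rankOneMatrix u (h.val.mulVec w) * _) = _
  rw [rankOneMatrix_mulVec_mul, proj_smul h.det_ne_zero, proj_rankOneMatrix hu hw]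

theorem rankOne_mul_reg (h : PGL(2, ℂ)) (a b : ℙ ℂ (Fin 2 → ℂ)) :
    rankOne a b * reg h = rankOne a (h⁻¹ • b) := by
  rw [← rankOne_smul_mul_reg h a (h⁻¹ • b), smul_inv_smul]

theorem rankOne_mul_rankOne_of_ne {b c : ℙ ℂ (Fin 2 → ℂ)} (h : c ≠ b) (a d : ℙ ℂ (Fin 2 → ℂ)) :
    rankOne a b * rankOne c d = rankOne a d := by
  rw [rankOne, rankOne, ← map_mul, rankOneMatrix_mul_rankOneMatrix, proj_smul, rankOne]
  rwa [Ne, cross_eq_zero_iff c.rep_nonzero b.rep_nonzero, c.mk_rep, b.mk_rep]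

theorem rankOne_mul_rankOne_self (a b d : ℙ ℂ (Fin 2 → ℂ)) :
    rankOne a b * rankOne b d = proj 0 := by
  rw [rankOne, rankOne, ← map_mul, rankOneMatrix_mul_rankOneMatrix,
    (cross_eq_zero_iff b.rep_nonzero b.rep_nonzero).2 rfl, zero_smul]

theorem finite_setOf_rankOne_mem_of_finite_imageLines {M : Submonoid PM2}
    (h : (imageLines M).Finite) : {a | ∃ b, rankOne a b ∈ M}.Finite := by
  refine .of_finite_image (f := Projectivization.submodule) (h.subset ?_)
    Projectivization.submodule_injective.injOn
  rintro _ ⟨a, ⟨b, hab⟩, rfl⟩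
  refine ⟨_, rank_rankOneMatrix a.rep_nonzero b.rep_nonzero, hab, ?_⟩
  rw [range_rankOneMatrix b.rep_nonzero, Projectivization.submodule_eq]

theorem finite_setOf_rankOne_mem_of_finite_kernelLines {M : Submonoid PM2}
    (h : (kernelLines M).Finite) : {b | ∃ a, rankOne a b ∈ M}.Finite := by
  refine .of_finite_image (f := Projectivization.submodule) (h.subset ?_)
    Projectivization.submodule_injective.injOn
  rintro _ ⟨b, ⟨a, hab⟩, rfl⟩
  refine ⟨_, rank_rankOneMatrix a.rep_nonzero b.rep_nonzero, hab, ?_⟩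
  rw [ker_rankOneMatrix a.rep_nonzero b.rep_nonzero, Projectivization.submodule_eq]

end PM2

/-! ### Definable subsets of ℂP¹ and of PM₂(ℂ) -/

theorem Set.Definable.of_eq {L : FirstOrder.Language} {M α : Type*} [L.Structure M] {A : Set M}
    {s t : Set (α → M)} (hs : A.Definable L s) (h : s = t) : A.Definable L t :=
  h ▸ hs

section DefinableFun

open FirstOrder FirstOrder.Ring

variable {R α : Type*} [CommRing R] [CompatibleRing R] {A : Set R} {f g : (α → R) → R}

theorem Set.DefinableFun.mul (hf : A.DefinableFun Language.ring f)
    (hg : A.DefinableFun Language.ring g) : A.DefinableFun Language.ring fun v => f v * g v := by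
  have h : A.DefinableMap Language.ring (fun v => ![f v, g v]) := fun i => by
    fin_cases i
    exacts [hf, hg]
  simpa using DefinableFun.comp h
    (.of_empty (DefinableFun.fun_symbol (L := Language.ring) mulFunc))

theorem Set.DefinableFun.add (hf : A.DefinableFun Language.ring f)
    (hg : A.DefinableFun Language.ring g) : A.DefinableFun Language.ring fun v => f v + g v := by
  have h : A.DefinableMap Language.ring (fun v => ![f v, g v]) := fun i => by
    fin_cases i
    exacts [hf, hg]
  simpa using DefinableFun.comp h
    (.of_empty (DefinableFun.fun_symbol (L := Language.ring) addFunc))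

theorem Set.DefinableFun.neg (hf : A.DefinableFun Language.ring f) :
    A.DefinableFun Language.ring fun v => -f v := by
  have h : A.DefinableMap Language.ring (fun v => ![f v]) := fun i => by
    fin_cases i
    exact hf
  simpa using DefinableFun.comp h
    (.of_empty (DefinableFun.fun_symbol (L := Language.ring) negFunc))

end DefinableFun

namespace PM2

open FirstOrder FirstOrder.Ring

attribute [local instance] FirstOrder.Ring.compatibleRingOfRing

/-- A subset of `ℂP¹` is definable if the cone over it, without the origin, is definable. -/
def LineDefinable (Y : Set (ℙ ℂ (Fin 2 → ℂ))) : Prop :=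
  (Set.univ : Set ℂ).Definable Language.ring
    {u : Fin 2 → ℂ | ∃ hu : u ≠ 0, Projectivization.mk ℂ u hu ∈ Y}

theorem definable_setOf_eq {α β : Type*} [Finite β] {f g : (α → ℂ) → β → ℂ}
    (hf : (Set.univ : Set ℂ).DefinableMap Language.ring f)
    (hg : (Set.univ : Set ℂ).DefinableMap Language.ring g) :
    (Set.univ : Set ℂ).Definable Language.ring {v | f v = g v} := by
  have h := Set.definable_iInter_of_finite fun b => Set.DefinableFun.ofPred_eq (hf b) (hg b)
  convert h using 1
  ext v
  simp [funext_iff]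

theorem definableFun_const {α : Type*} (a : ℂ) :
    (Set.univ : Set ℂ).DefinableFun Language.ring fun _ : α → ℂ => a :=
  Language.definableFun_const Language.ring α (Set.mem_univ a)

theorem definable_setOf_ne_zero {α : Type*} [Finite α] :
    (Set.univ : Set ℂ).Definable Language.ring {u : α → ℂ | u ≠ 0} :=
  (definable_setOf_eq (f := fun u => u) (g := fun _ => 0) (fun _ => .proj _)
    fun _ => definableFun_const 0).compl

theorem lineDefinable_univ : LineDefinable Set.univ := by
  simpa [LineDefinable] using definable_setOf_ne_zero

theorem LineDefinable.inter {Y Z : Set (ℙ ℂ (Fin 2 → ℂ))} (hY : LineDefinable Y)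
    (hZ : LineDefinable Z) : LineDefinable (Y ∩ Z) := by
  refine Set.Definable.of_eq (Set.Definable.inter hY hZ) ?_
  ext u
  constructor
  · rintro ⟨⟨hu, h⟩, _, h'⟩
    exact ⟨hu, h, h'⟩
  · rintro ⟨hu, h, h'⟩
    exact ⟨⟨hu, h⟩, hu, h'⟩

theorem LineDefinable.compl {Y : Set (ℙ ℂ (Fin 2 → ℂ))} (hY : LineDefinable Y) :
    LineDefinable Yᶜ := by
  refine Set.Definable.of_eq (lineDefinable_univ.sdiff hY) ?_
  ext u
  constructor
  · rintro ⟨⟨hu, -⟩, h'⟩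
    exact ⟨hu, fun h => h' ⟨hu, h⟩⟩
  · rintro ⟨hu, h⟩
    exact ⟨⟨hu, trivial⟩, fun ⟨_, h'⟩ => h h'⟩

theorem LineDefinable.union {Y Z : Set (ℙ ℂ (Fin 2 → ℂ))} (hY : LineDefinable Y)
    (hZ : LineDefinable Z) : LineDefinable (Y ∪ Z) := by
  rw [← compl_compl (Y ∪ Z), Set.compl_union]
  exact (hY.compl.inter hZ.compl).compl

theorem lineDefinable_singleton (a : ℙ ℂ (Fin 2 → ℂ)) : LineDefinable {a} := by
  have h := definable_setOf_eq (α := Fin 2) (β := Unit)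
    (f := fun u _ => a.rep 1 * u 0 + -(a.rep 0 * u 1)) (g := fun _ _ => 0)
    (fun _ => ((definableFun_const _).mul (.proj _)).add
      ((definableFun_const _).mul (.proj _)).neg) fun _ => definableFun_const 0
  refine Set.Definable.of_eq (definable_setOf_ne_zero.inter h) ?_
  ext u
  simp only [funext_iff, Set.mem_inter_iff, Set.mem_ofPred_eq, forall_const, ← sub_eq_add_neg,
    Set.mem_singleton_iff]
  constructor
  · rintro ⟨hu, h⟩
    have hu' : u ≠ 0 := by simpa [funext_iff] using hu
    exact ⟨hu', by rw [(cross_eq_zero_iff hu' a.rep_nonzero).1 h, a.mk_rep]⟩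
  · rintro ⟨hu, h⟩
    exact ⟨hu, (cross_eq_zero_iff hu a.rep_nonzero).2 (by rw [h, a.mk_rep])⟩

theorem _root_.Set.Finite.lineDefinable {Y : Set (ℙ ℂ (Fin 2 → ℂ))} (hY : Y.Finite) :
    LineDefinable Y := by
  induction Y, hY using Set.Finite.induction_on with
  | empty => simpa using lineDefinable_univ.compl
  | insert _ _ ih => exact (lineDefinable_singleton _).union ih

theorem LineDefinable.finite_or_finite_compl {Y : Set (ℙ ℂ (Fin 2 → ℂ))} (hY : LineDefinable Y) :
    Y.Finite ∨ Yᶜ.Finite := by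
  have hne : ∀ z : ℂ, ![z, 1] ≠ 0 := fun z h => by simpa using congrFun h 1
  -- This affine chart misses only the point [1 : 0], so finiteness can be tested on preimages in ℂ.
  let f : ℂ → ℙ ℂ (Fin 2 → ℂ) := fun z => .mk ℂ ![z, 1] (hne z)
  have hf : ∀ Z : Set (ℙ ℂ (Fin 2 → ℂ)), (f ⁻¹' Z).Finite → Z.Finite := by
    intro Z hZ
    refine ((hZ.image f).union (Set.finite_singleton (.mk ℂ ![1, 0] (by simp)))).subset ?_
    intro a ha
    induction a using Projectivization.ind with | _ u hu =>
    by_cases h1 : u 1 = 0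
    · right
      refine (cross_eq_zero_iff _ _).1 ?_
      simp [h1]
    · left
      have : f (u 0 / u 1) = .mk ℂ u hu := (cross_eq_zero_iff _ _).1 (by simp; field_simp; simp)
      exact ⟨u 0 / u 1, by rwa [Set.mem_preimage, this], this⟩
  have hS : (Set.univ : Set ℂ).Definable₁ Language.ring (f ⁻¹' Y) := by
    have h := Set.Definable.preimage_map (A := Set.univ) (L := Language.ring) (α := Fin 1)
      (F := fun z => ![z 0, 1]) (fun i => by
        fin_cases i
        exacts [.proj _, definableFun_const 1]) hY
    refine Set.Definable.of_eq h ?_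
    ext z
    exact ⟨fun ⟨_, h⟩ => h, fun h => ⟨hne _, h⟩⟩
  exact (IsAlgClosed.finite_or_finite_compl_of_definable hS).imp (hf _) (hf _)

theorem Definable.union {X Y : Set PM2} (hX : Definable X) (hY : Definable Y) :
    Definable (X ∪ Y) :=
  Set.Definable.union hX hY

theorem definable_empty : Definable ∅ :=
  Set.definable_empty

theorem definable_biUnion {ι : Type*} {s : Set ι} (hs : s.Finite) {X : ι → Set PM2}
    (hX : ∀ i ∈ s, Definable (X i)) : Definable (⋃ i ∈ s, X i) := by
  induction s, hs using Set.Finite.induction_on with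
  | empty => simpa using definable_empty
  | insert _ _ ih =>
    rw [Set.biUnion_insert]
    exact (hX _ (Set.mem_insert _ _)).union (ih fun i hi => hX i (Set.mem_insert_of_mem _ hi))

theorem definable_singleton_zero : Definable {proj 0} := by
  have h := definable_setOf_ne_zero (α := Fin 2 × Fin 2).compl
  refine Set.Definable.of_eq h ?_
  ext x
  simp only [ne_eq, Set.mem_compl_iff, Set.mem_ofPred_eq, not_not, Set.mem_singleton_iff]
  constructor
  · rintro rfl
    rfl
  · intro h
    obtain ⟨c, hc⟩ := proj_eq_proj_iff.1 h.symm
    rw [smul_zero] at hc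
    ext ij
    exact congrFun (congrFun hc ij.1) ij.2

theorem definable_regular {H : Subgroup PGL(2, ℂ)} (hH : IsAlgebraicSubgroup H) :
    Definable (reg '' H) := by
  obtain ⟨P, hP⟩ := hH
  -- By Hilbert's basis theorem finitely many equations suffice, as a first-order formula requires.
  obtain ⟨S, hSP, hS⟩ := Submodule.fg_span_iff_fg_span_finset_subset P |>.1
    (IsNoetherian.noetherian (Ideal.span P))
  have h1 := (mvPolynomial_zeroLocus_definable S).mono (Set.subset_univ _)
  have h2 := (definable_setOf_eq (α := Fin 2 × Fin 2) (β := Unit)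
    (f := fun x _ => x (0, 0) * x (1, 1) + -(x (0, 1) * x (1, 0))) (g := fun _ _ => 0)
    (fun _ => .add (.mul (.proj _) (.proj _)) (.neg (.mul (.proj _) (.proj _)))) fun _ => definableFun_const 0).compl
  refine Set.Definable.of_eq (h2.inter h1) ?_
  have hspan : Ideal.span (S : Set (MvPolynomial (Fin 2 × Fin 2) ℂ)) = Ideal.span P := hS.symm
  ext x
  have hdet : (Matrix.of fun i j => x (i, j)).det =
      x (0, 0) * x (1, 1) + -(x (0, 1) * x (1, 0)) := by
    simp [Matrix.det_fin_two, sub_eq_add_neg]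
  rw [hspan, MvPolynomial.zeroLocus_span]
  simp only [Set.mem_inter_iff, Set.mem_compl_iff, Set.mem_ofPred_eq, funext_iff, forall_const,
    ← hdet]
  have heval : ∀ (hd : (Matrix.of fun i j => x (i, j)).det ≠ 0) (p : MvPolynomial _ ℂ),
      MvPolynomial.aeval x p = MvPolynomial.eval (fun ij : Fin 2 × Fin 2 =>
        (Matrix.GeneralLinearGroup.mkOfDetNeZero _ hd).val ij.1 ij.2) p := fun hd p => by
    rw [← MvPolynomial.aeval_eq_eval]
    rfl
  constructor
  · rintro ⟨hd, hx⟩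
    refine ⟨_, (hP (.mkOfDetNeZero _ hd)).2 fun p hp => ?_, reg_mk_mkOfDetNeZero _ hd⟩
    rw [← heval hd]
    exact hx p hp
  · rintro ⟨h, hh, he⟩
    have hd : (Matrix.of fun i j => x (i, j)).det ≠ 0 := fun hd => proj_ne_reg hd h he.symm
    have hm : h = .mk (.mkOfDetNeZero _ hd) := reg_injective (he.trans (reg_mk_mkOfDetNeZero _ hd).symm)
    subst hm
    refine ⟨hd, fun p hp => ?_⟩
    rw [heval hd]
    exact (hP _).1 hh p hp

theorem LineDefinable.rankOne {Y Z : Set (ℙ ℂ (Fin 2 → ℂ))} (hY : LineDefinable Y)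
    (hZ : LineDefinable Z) : Definable (Set.image2 rankOne Y Z) := by
  have h1 := hY.preimage_comp (Sum.inr ∘ Sum.inl : Fin 2 → (Fin 2 × Fin 2) ⊕ (Fin 2 ⊕ Fin 2))
  have h2 := hZ.preimage_comp (Sum.inr ∘ Sum.inr : Fin 2 → (Fin 2 × Fin 2) ⊕ (Fin 2 ⊕ Fin 2))
  have h3 := definable_setOf_eq (α := (Fin 2 × Fin 2) ⊕ (Fin 2 ⊕ Fin 2)) (β := Fin 2 × Fin 2)
    (f := fun v ij => v (.inl ij))
    (g := fun v ij => v (.inr (.inl ij.1)) *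
      ![v (.inr (.inr 1)), -v (.inr (.inr 0))] ij.2) (fun _ => .proj _) (fun ij => by
        obtain ⟨i, j⟩ := ij
        fin_cases j
        exacts [.mul (.proj _) (.proj _), .mul (.proj _) (.neg (.proj _))])
  refine Set.Definable.of_eq (((h1.inter h2).inter h3).exists_of_finite) ?_
  ext x
  constructor
  · rintro ⟨v, ⟨⟨hu, hY⟩, ⟨hw, hZ⟩⟩, hv⟩
    refine ⟨_, hY, _, hZ, ?_⟩
    rw [← proj_rankOneMatrix]
    congr 1
    ext i j
    exact (congrFun hv (i, j)).symm
  · rintro ⟨a, ha, b, hb, he⟩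
    obtain ⟨c, hc⟩ := proj_eq_proj_iff.1 he
    -- The projective scalar is absorbed into the image vector, so the matrix itself, not just its
    -- class, has the required form.
    have hx : (Matrix.of fun i j => x (i, j)) = rankOneMatrix ((c : ℂ) • a.rep) b.rep := by
      rw [hc, ← one_smul ℂ b.rep, rankOneMatrix_smul_smul, one_smul, mul_one]
    have hca : (c : ℂ) • a.rep ≠ 0 := smul_ne_zero c.ne_zero a.rep_nonzero
    refine ⟨Sum.elim ((c : ℂ) • a.rep) b.rep, ⟨⟨hca, ?_⟩, ⟨b.rep_nonzero, ?_⟩⟩, ?_⟩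
    · have h : Projectivization.mk ℂ ((c : ℂ) • a.rep) hca = a := by
        conv_rhs => rw [← a.mk_rep]
        exact (Projectivization.mk_eq_mk_iff' ..).2 ⟨c, rfl⟩
      exact h.symm ▸ ha
    · exact b.mk_rep.symm ▸ hb
    · ext ij
      exact congrFun (congrFun hx ij.1) ij.2

theorem Definable.setOf_rankOne_left {X : Set PM2} (hX : Definable X) (b : ℙ ℂ (Fin 2 → ℂ)) :
    LineDefinable {a | rankOne a b ∈ X} := by
  have h := Set.Definable.preimage_map (A := Set.univ) (L := Language.ring) (α := Fin 2)
    (F := fun u (ij : Fin 2 × Fin 2) => u ij.1 * ![b.rep 1, -b.rep 0] ij.2)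
    (fun _ => .mul (.proj _) (definableFun_const _)) hX
  refine Set.Definable.of_eq (definable_setOf_ne_zero.inter h) ?_
  ext u
  constructor
  · rintro ⟨hu, h⟩
    refine ⟨hu, ?_⟩
    rw [← b.mk_rep, Set.mem_ofPred_eq, ← proj_rankOneMatrix]
    exact h
  · rintro ⟨hu, h⟩
    rw [← b.mk_rep, Set.mem_ofPred_eq, ← proj_rankOneMatrix] at h
    exact ⟨hu, h⟩

theorem Definable.setOf_rankOne_right {X : Set PM2} (hX : Definable X) (a : ℙ ℂ (Fin 2 → ℂ)) :
    LineDefinable {b | rankOne a b ∈ X} := by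
  have h := Set.Definable.preimage_map (A := Set.univ) (L := Language.ring) (α := Fin 2)
    (F := fun w (ij : Fin 2 × Fin 2) => a.rep ij.1 * ![w 1, -w 0] ij.2)
    (fun ij => by
      obtain ⟨i, j⟩ := ij
      fin_cases j
      exacts [.mul (definableFun_const _) (.proj _),
        .mul (definableFun_const _) (.neg (.proj _))]) hX
  refine Set.Definable.of_eq (definable_setOf_ne_zero.inter h) ?_
  ext u
  constructor
  · rintro ⟨hu, h⟩
    refine ⟨hu, ?_⟩
    rw [← a.mk_rep, Set.mem_ofPred_eq, ← proj_rankOneMatrix]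
    exact h
  · rintro ⟨hu, h⟩
    rw [← a.mk_rep, Set.mem_ofPred_eq, ← proj_rankOneMatrix] at h
    exact ⟨hu, h⟩

theorem lineDefinable_orbit {H : Subgroup PGL(2, ℂ)} (hH : IsAlgebraicSubgroup H)
    (a : ℙ ℂ (Fin 2 → ℂ)) : LineDefinable (MulAction.orbit H a) := by
  have h1 := Set.Definable.preimage_comp (Sum.inr : _ → Fin 2 ⊕ Fin 2 × Fin 2)
    (definable_regular hH)
  have h2 := definable_setOf_eq (α := Fin 2 ⊕ Fin 2 × Fin 2) (β := Fin 2)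
    (f := fun v i => v (.inl i))
    (g := fun v i => v (.inr (i, 0)) * a.rep 0 + v (.inr (i, 1)) * a.rep 1)
    (fun _ => .proj _) (fun _ => .add (.mul (.proj _) (definableFun_const _))
      (.mul (.proj _) (definableFun_const _)))
  refine Set.Definable.of_eq ((h1.inter h2).exists_of_finite) ?_
  have key : ∀ (g : GL (Fin 2) ℂ), (.mk g : PGL(2, ℂ)) • a =
      .mk ℂ (g • a.rep) ((smul_ne_zero_iff_ne g).2 a.rep_nonzero) := fun g => by
    conv_lhs => rw [← a.mk_rep]
    rfl
  ext u
  constructor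
  · rintro ⟨x, ⟨h, hh, he⟩, hu⟩
    induction h using Matrix.ProjGenLinGroup.induction_on with | mk g =>
    obtain ⟨c, hc⟩ := proj_eq_proj_iff.1 he
    have hu' : u = c • g • a.rep := by
      ext i
      refine (congrFun hu i).trans ?_
      have h0 : x (i, 0) = c * g.val i 0 := congrFun (congrFun hc i) 0
      have h1 : x (i, 1) = c * g.val i 1 := congrFun (congrFun hc i) 1
      change x (i, 0) * _ + x (i, 1) * _ = c * (g.val.mulVec a.rep i)
      rw [h0, h1, Matrix.mulVec, dotProduct, Fin.sum_univ_two]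
      ring
    have hne : u ≠ 0 := by
      rw [hu']
      exact (smul_ne_zero_iff_ne c).2 ((smul_ne_zero_iff_ne g).2 a.rep_nonzero)
    refine ⟨hne, ⟨_, hh⟩, ?_⟩
    refine (key g).trans ((Projectivization.mk_eq_mk_iff ..).2 ⟨c⁻¹, ?_⟩)
    rw [hu', inv_smul_smul]
  · rintro ⟨hu, ⟨h, hh⟩, he⟩
    induction h using Matrix.ProjGenLinGroup.induction_on with | mk g =>
    obtain ⟨c, hc⟩ := (Projectivization.mk_eq_mk_iff ..).1 ((key g).symm.trans he)
    -- Rescaling the matrix by `c⁻¹` makes it send `a.rep` exactly to `u`.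
    refine ⟨fun ij => (c⁻¹ : ℂ) * g.val ij.1 ij.2, ⟨_, hh, ?_⟩, ?_⟩
    · refine proj_eq_proj_iff.2 ⟨c⁻¹, ?_⟩
      ext i j
      simp
    · ext i
      have : u = c⁻¹ • g • a.rep := by rw [← hc, inv_smul_smul]
      rw [this]
      change (↑c⁻¹ : ℂ) * (g.val.mulVec a.rep i) = _
      rw [Matrix.mulVec, dotProduct, Fin.sum_univ_two]
      simp
      ring

end PM2

/-! ### Definable overmonoids, and separation when zero lies in M -/

namespace PM2

variable {M : Submonoid PM2} {H : Subgroup PGL(2, ℂ)}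

theorem IsRegularPart.reg_mem_iff (hMH : IsRegularPart M H) (h : PGL(2, ℂ)) :
    reg h ∈ M ↔ h ∈ H := by
  induction h using Matrix.ProjGenLinGroup.induction_on with | mk g =>
  exact (hMH g).symm

theorem IsRegularPart.smul_rankOne_mem (hMH : IsRegularPart M H) {h : PGL(2, ℂ)} (hh : h ∈ H)
    {a b : ℙ ℂ (Fin 2 → ℂ)} (hab : rankOne a b ∈ M) : rankOne (h • a) b ∈ M := by
  rw [← reg_mul_rankOne]
  exact M.mul_mem ((hMH.reg_mem_iff h).2 hh) hab

theorem IsRegularPart.rankOne_smul_mem (hMH : IsRegularPart M H) {h : PGL(2, ℂ)} (hh : h ∈ H)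
    {a b : ℙ ℂ (Fin 2 → ℂ)} (hab : rankOne a b ∈ M) : rankOne a (h • b) ∈ M := by
  rw [← inv_inv h, ← rankOne_mul_reg]
  exact M.mul_mem hab ((hMH.reg_mem_iff _).2 (H.inv_mem hh))

theorem IsRegularPart.coe_subset (hMH : IsRegularPart M H) {S : Set PM2}
    (h0 : proj 0 ∈ M → proj 0 ∈ S) (hS : ∀ a b, rankOne a b ∈ M → rankOne a b ∈ S) :
    (M : Set PM2) ⊆ reg '' H ∪ S := by
  intro x hx
  obtain ⟨h, rfl⟩ | rfl | ⟨a, b, rfl⟩ := eq_reg_or_eq_zero_or_eq_rankOne x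
  · exact .inl ⟨h, (hMH.reg_mem_iff h).1 hx, rfl⟩
  · exact .inr (h0 hx)
  · exact .inr (hS a b hx)

/-- The submonoid of `PM₂(ℂ)` with regular elements `H` and further elements `S`. -/
def ofRegularSingular (H : Subgroup PGL(2, ℂ)) (S : Set PM2)
    (hl : ∀ h ∈ H, ∀ s ∈ S, reg h * s ∈ S) (hr : ∀ h ∈ H, ∀ s ∈ S, s * reg h ∈ S)
    (hS : ∀ s ∈ S, ∀ t ∈ S, s * t ∈ S) : Submonoid PM2 where
  carrier := reg '' H ∪ S
  one_mem' := .inl ⟨1, H.one_mem, map_one reg⟩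
  mul_mem' := by
    rintro _ _ (⟨h, hh, rfl⟩ | hs) (⟨k, hk, rfl⟩ | ht)
    · exact .inl ⟨h * k, H.mul_mem hh hk, map_mul reg h k⟩
    · exact .inr (hl h hh _ ht)
    · exact .inr (hr k hk _ hs)
    · exact .inr (hS _ hs _ ht)

theorem exists_definable_zero_union_image2 (hH : IsAlgebraicSubgroup H)
    {A B : Set (ℙ ℂ (Fin 2 → ℂ))} (hA : LineDefinable A) (hB : LineDefinable B)
    (hHA : ∀ h ∈ H, ∀ a ∈ A, h • a ∈ A) (hHB : ∀ h ∈ H, ∀ b ∈ B, h • b ∈ B) :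
    ∃ N : Submonoid PM2, IsDefinableMonoid N ∧
      (N : Set PM2) = reg '' H ∪ ({proj 0} ∪ Set.image2 rankOne A B) := by
  refine ⟨ofRegularSingular H ({proj 0} ∪ Set.image2 rankOne A B) ?_ ?_ ?_,
    (definable_regular hH).union (definable_singleton_zero.union (hA.rankOne hB)), rfl⟩
  · rintro h hh _ (rfl | ⟨a, ha, b, hb, rfl⟩)
    · exact .inl (mul_proj_zero _)
    · rw [reg_mul_rankOne]
      exact .inr ⟨_, hHA h hh a ha, b, hb, rfl⟩
  · rintro h hh _ (rfl | ⟨a, ha, b, hb, rfl⟩)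
    · exact .inl (proj_zero_mul _)
    · rw [rankOne_mul_reg]
      exact .inr ⟨a, ha, _, hHB _ (H.inv_mem hh) b hb, rfl⟩
  · rintro _ (rfl | ⟨a, ha, b, hb, rfl⟩) _ (rfl | ⟨c, hc, d, hd, rfl⟩)
    · exact .inl (proj_zero_mul _)
    · exact .inl (proj_zero_mul _)
    · exact .inl (mul_proj_zero _)
    · by_cases h : c = b
      · subst h
        exact .inl (rankOne_mul_rankOne_self _ _ _)
      · rw [rankOne_mul_rankOne_of_ne h]
        exact .inr ⟨a, ha, d, hd, rfl⟩

/-- Disjointness of images and kernels prevents zero from occurring as a product. -/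
theorem exists_definable_image2 (hH : IsAlgebraicSubgroup H)
    {A B : Set (ℙ ℂ (Fin 2 → ℂ))} (hA : LineDefinable A) (hB : LineDefinable B)
    (hHA : ∀ h ∈ H, ∀ a ∈ A, h • a ∈ A) (hHB : ∀ h ∈ H, ∀ b ∈ B, h • b ∈ B)
    (hAB : Disjoint A B) :
    ∃ N : Submonoid PM2, IsDefinableMonoid N ∧
      (N : Set PM2) = reg '' H ∪ Set.image2 rankOne A B := by
  refine ⟨ofRegularSingular H (Set.image2 rankOne A B) ?_ ?_ ?_,
    (definable_regular hH).union (hA.rankOne hB), rfl⟩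
  · rintro h hh _ ⟨a, ha, b, hb, rfl⟩
    rw [reg_mul_rankOne]
    exact ⟨_, hHA h hh a ha, b, hb, rfl⟩
  · rintro h hh _ ⟨a, ha, b, hb, rfl⟩
    rw [rankOne_mul_reg]
    exact ⟨a, ha, _, hHB _ (H.inv_mem hh) b hb, rfl⟩
  · rintro _ ⟨a, ha, b, hb, rfl⟩ _ ⟨c, hc, d, hd, rfl⟩
    rw [rankOne_mul_rankOne_of_ne (hAB.ne_of_mem hc hb)]
    exact ⟨a, ha, d, hd, rfl⟩

/-- Suppose (x, y)(z, w) is non-zero, so z ≠ y. If x ≠ b then y = b, hence z ≠ b, which forces w =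
b: the product again has image or kernel `b`. -/
theorem exists_definable_of_fixed (hH : IsAlgebraicSubgroup H) {b : ℙ ℂ (Fin 2 → ℂ)}
    (hb : ∀ h ∈ H, h • b = b) :
    ∃ N : Submonoid PM2, IsDefinableMonoid N ∧
      (N : Set PM2) = reg '' H ∪ ({proj 0} ∪
        (Set.image2 rankOne {b} Set.univ ∪ Set.image2 rankOne Set.univ {b})) := by
  have hs := lineDefinable_singleton b
  refine ⟨ofRegularSingular H ({proj 0} ∪
      (Set.image2 rankOne {b} Set.univ ∪ Set.image2 rankOne Set.univ {b})) ?_ ?_ ?_,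
    (definable_regular hH).union (definable_singleton_zero.union
      ((hs.rankOne lineDefinable_univ).union (lineDefinable_univ.rankOne hs))), rfl⟩
  · rintro h hh _ (rfl | ⟨a, rfl, c, -, rfl⟩ | ⟨c, -, a, rfl, rfl⟩)
    · exact .inl (mul_proj_zero _)
    · rw [reg_mul_rankOne, hb h hh]
      exact .inr (.inl ⟨_, rfl, c, trivial, rfl⟩)
    · rw [reg_mul_rankOne]
      exact .inr (.inr ⟨_, trivial, _, rfl, rfl⟩)
  · rintro h hh _ (rfl | ⟨a, rfl, c, -, rfl⟩ | ⟨c, -, a, rfl, rfl⟩)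
    · exact .inl (proj_zero_mul _)
    · rw [rankOne_mul_reg]
      exact .inr (.inl ⟨_, rfl, _, trivial, rfl⟩)
    · rw [rankOne_mul_reg, hb _ (H.inv_mem hh)]
      exact .inr (.inr ⟨c, trivial, _, rfl, rfl⟩)
  · have key : ∀ {x y z w : ℙ ℂ (Fin 2 → ℂ)}, (z ≠ y → x = b ∨ w = b) →
        rankOne x y * rankOne z w ∈ ({proj 0} ∪
          (Set.image2 rankOne {b} Set.univ ∪ Set.image2 rankOne Set.univ {b}) : Set PM2) := by
      intro x y z w h
      by_cases hzy : z = y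
      · subst hzy
        exact .inl (rankOne_mul_rankOne_self _ _ _)
      · rw [rankOne_mul_rankOne_of_ne hzy]
        exact .inr ((h hzy).imp (fun h => ⟨x, h, w, trivial, rfl⟩)
          fun h => ⟨x, trivial, w, h, rfl⟩)
    rintro _ (rfl | ⟨a, rfl, c, -, rfl⟩ | ⟨c, -, a, rfl, rfl⟩) t ht
    · exact .inl (proj_zero_mul _)
    · obtain rfl | ⟨_, rfl, d, -, rfl⟩ | ⟨d, -, _, rfl, rfl⟩ := ht
      · exact .inl (mul_proj_zero _)
      · exact key fun _ => .inl rfl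
      · exact key fun _ => .inl rfl
    · obtain rfl | ⟨_, rfl, d, -, rfl⟩ | ⟨d, -, _, rfl, rfl⟩ := ht
      · exact .inl (mul_proj_zero _)
      · exact key fun h => absurd rfl h
      · exact key fun _ => .inr rfl

theorem isInterOfDefinableMonoids_of_separated
    (h : ∀ x ∉ M, ∃ N : Submonoid PM2, IsDefinableMonoid N ∧ M ≤ N ∧ x ∉ N) :
    IsInterOfDefinableMonoids M := by
  refine ⟨{N | IsDefinableMonoid N ∧ M ≤ N}, fun N hN => hN.1, ?_⟩
  refine Set.Subset.antisymm (Set.subset_iInter₂ fun N hN => hN.2) fun x hx => ?_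
  by_contra hxM
  obtain ⟨N, hN, hMN, hxN⟩ := h x hxM
  exact hxN (Set.mem_iInter₂.1 hx N ⟨hN, hMN⟩)

theorem smul_mem_compl {A : Set (ℙ ℂ (Fin 2 → ℂ))} (hA : ∀ h ∈ H, ∀ a ∈ A, h • a ∈ A)
    {h : PGL(2, ℂ)} (hh : h ∈ H) {a : ℙ ℂ (Fin 2 → ℂ)} (ha : a ∈ Aᶜ) : h • a ∈ Aᶜ := by
  intro h'
  have := hA h⁻¹ (H.inv_mem hh) _ h'
  rw [inv_smul_smul] at this
  exact ha this

theorem smul_mem_compl_orbit {h : PGL(2, ℂ)} (hh : h ∈ H) {p a : ℙ ℂ (Fin 2 → ℂ)}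
    (ha : a ∈ (MulAction.orbit H p)ᶜ) : h • a ∈ (MulAction.orbit H p)ᶜ :=
  smul_mem_compl (fun k hk _ => MulAction.mem_orbit_of_mem_orbit (⟨k, hk⟩ : H)) hh ha

theorem rankOne_mem_image2_iff {A B : Set (ℙ ℂ (Fin 2 → ℂ))} {a b : ℙ ℂ (Fin 2 → ℂ)} :
    rankOne a b ∈ Set.image2 rankOne A B ↔ a ∈ A ∧ b ∈ B :=
  Set.mem_image2_iff rankOne_injective2

theorem rankOne_notMem_reg (a b : ℙ ℂ (Fin 2 → ℂ)) : rankOne a b ∉ reg '' H := by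
  rintro ⟨h, -, hh⟩
  exact rankOne_ne_reg a b h hh.symm

theorem isInterOfDefinableMonoids_of_zero_mem (hMH : IsRegularPart M H)
    (hH : IsAlgebraicSubgroup H) (h0 : proj 0 ∈ M) : IsInterOfDefinableMonoids M := by
  refine isInterOfDefinableMonoids_of_separated fun x hx => ?_
  obtain ⟨h, rfl⟩ | rfl | ⟨p, q, rfl⟩ := eq_reg_or_eq_zero_or_eq_rankOne x
  · obtain ⟨N, hN, hNe⟩ := exists_definable_zero_union_image2 hH lineDefinable_univ
      lineDefinable_univ (fun _ _ _ _ => trivial) (fun _ _ _ _ => trivial)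
    refine ⟨N, hN, ?_, ?_⟩
    · rw [← SetLike.coe_subset_coe, hNe]
      exact hMH.coe_subset (fun _ => .inl rfl) fun a b _ => .inr ⟨a, trivial, b, trivial, rfl⟩
    · rw [← SetLike.mem_coe, hNe]
      rintro (⟨k, hk, hkh⟩ | hh | ⟨a, -, b, -, hh⟩)
      · exact hx ((hMH.reg_mem_iff h).2 (reg_injective hkh ▸ hk))
      · exact proj_zero_ne_reg h hh.symm
      · exact rankOne_ne_reg a b h hh
  · exact absurd h0 hx
  by_cases hp : ∃ b, rankOne p b ∈ M
  · by_cases hq : ∃ c, rankOne c q ∈ M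
    · obtain ⟨b, hb⟩ := hp
      obtain ⟨c, hc⟩ := hq
      -- If the kernel of the first factor and the image of the second differed, the product would
      -- be the missing pair (p, q). Hence both are one and the same point, which H must fix.
      have key : ∀ {y z}, rankOne p y ∈ M → rankOne z q ∈ M → z = y := by
        intro y z hy hz
        by_contra h
        exact hx (rankOne_mul_rankOne_of_ne h p q ▸ M.mul_mem hy hz)
      obtain rfl := key hb hc
      have hfix : ∀ h ∈ H, h • c = c := fun h hh =>
        (key (hMH.rankOne_smul_mem hh hb) hc).symm
      obtain ⟨N, hN, hNe⟩ := exists_definable_of_fixed hH hfix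
      refine ⟨N, hN, ?_, ?_⟩
      · rw [← SetLike.coe_subset_coe, hNe]
        refine hMH.coe_subset (fun _ => .inl rfl) fun a d had => .inr ?_
        by_cases hd : d = c
        · exact .inr ⟨a, trivial, d, hd, rfl⟩
        · refine .inl ⟨a, ?_, d, trivial, rfl⟩
          have h := M.mul_mem had hc
          rw [rankOne_mul_rankOne_of_ne (Ne.symm hd)] at h
          exact key hb h
      · rw [← SetLike.mem_coe, hNe]
        rintro (h | h | h | h)
        · exact rankOne_notMem_reg _ _ h
        · exact rankOne_ne_proj_zero _ _ h
        · exact hx ((rankOne_mem_image2_iff.1 h).1 ▸ hc)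
        · exact hx ((rankOne_mem_image2_iff.1 h).2 ▸ hb)
    · obtain ⟨N, hN, hNe⟩ := exists_definable_zero_union_image2 hH lineDefinable_univ
        (lineDefinable_orbit hH q).compl (fun _ _ _ _ => trivial)
        (fun h hh b hb => smul_mem_compl_orbit hh hb)
      refine ⟨N, hN, ?_, ?_⟩
      · rw [← SetLike.coe_subset_coe, hNe]
        refine hMH.coe_subset (fun _ => .inl rfl) fun a b hab => .inr ⟨a, trivial, b, ?_, rfl⟩
        intro h
        obtain ⟨k, rfl⟩ := MulAction.mem_orbit_symm.1 h
        exact hq ⟨a, hMH.rankOne_smul_mem k.2 hab⟩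
      · rw [← SetLike.mem_coe, hNe]
        rintro (h | h | h)
        · exact rankOne_notMem_reg _ _ h
        · exact rankOne_ne_proj_zero _ _ h
        · exact (rankOne_mem_image2_iff.1 h).2 (MulAction.mem_orbit_self q)
  · obtain ⟨N, hN, hNe⟩ := exists_definable_zero_union_image2 hH
      (lineDefinable_orbit hH p).compl lineDefinable_univ
      (fun h hh b hb => smul_mem_compl_orbit hh hb) (fun _ _ _ _ => trivial)
    refine ⟨N, hN, ?_, ?_⟩
    · rw [← SetLike.coe_subset_coe, hNe]
      refine hMH.coe_subset (fun _ => .inl rfl) fun a b hab => .inr ⟨a, ?_, b, trivial, rfl⟩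
      intro h
      obtain ⟨k, rfl⟩ := MulAction.mem_orbit_symm.1 h
      exact hp ⟨b, hMH.smul_rankOne_mem k.2 hab⟩
    · rw [← SetLike.mem_coe, hNe]
      rintro (h | h | h)
      · exact rankOne_notMem_reg _ _ h
      · exact rankOne_ne_proj_zero _ _ h
      · exact (rankOne_mem_image2_iff.1 h).1 (MulAction.mem_orbit_self p)

/-! ### Monoids without zero -/

theorem rankOne_ne_of_zero_notMem (h0 : proj 0 ∉ M) {a b c d : ℙ ℂ (Fin 2 → ℂ)}
    (hab : rankOne a b ∈ M) (hcd : rankOne c d ∈ M) : c ≠ b := by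
  rintro rfl
  exact h0 (rankOne_mul_rankOne_self a c d ▸ M.mul_mem hab hcd)

/-- This makes the rank-one part the full product of the set of images and the set of kernels. -/
theorem rankOne_mem_of_zero_notMem (h0 : proj 0 ∉ M) {a b c d : ℙ ℂ (Fin 2 → ℂ)}
    (hab : rankOne a b ∈ M) (hcd : rankOne c d ∈ M) : rankOne a d ∈ M :=
  rankOne_mul_rankOne_of_ne (rankOne_ne_of_zero_notMem h0 hab hcd) a d ▸ M.mul_mem hab hcd

/-- Since the rank-one part is a product, a missing pair (p, q) fails in one coordinate. Removing
the orbit of that coordinate from `A` or `B` preserves invariance and disjointness. -/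
theorem isInterOfDefinableMonoids_of_disjoint (hMH : IsRegularPart M H)
    (hH : IsAlgebraicSubgroup H) (h0 : proj 0 ∉ M) {A B : Set (ℙ ℂ (Fin 2 → ℂ))}
    (hA : LineDefinable A) (hB : LineDefinable B)
    (hHA : ∀ h ∈ H, ∀ a ∈ A, h • a ∈ A) (hHB : ∀ h ∈ H, ∀ b ∈ B, h • b ∈ B)
    (hAB : Disjoint A B) (hMA : ∀ a b, rankOne a b ∈ M → a ∈ A)
    (hMB : ∀ a b, rankOne a b ∈ M → b ∈ B) : IsInterOfDefinableMonoids M := by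
  refine isInterOfDefinableMonoids_of_separated fun x hx => ?_
  by_cases hxr : ∃ p q, x = rankOne p q
  · obtain ⟨p, q, rfl⟩ := hxr
    by_cases hp : ∃ b, rankOne p b ∈ M
    · have hq : ¬ ∃ c, rankOne c q ∈ M := by
        rintro ⟨c, hc⟩
        obtain ⟨b, hb⟩ := hp
        exact hx (rankOne_mem_of_zero_notMem h0 hb hc)
      obtain ⟨N, hN, hNe⟩ := exists_definable_image2 hH hA
        (hB.inter (lineDefinable_orbit hH q).compl) hHA
        (fun h hh b hb => ⟨hHB h hh b hb.1, smul_mem_compl_orbit hh hb.2⟩)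
        (hAB.mono_right Set.inter_subset_left)
      refine ⟨N, hN, ?_, ?_⟩
      · rw [← SetLike.coe_subset_coe, hNe]
        refine hMH.coe_subset (fun h => absurd h h0)
          fun a b hab => ⟨a, hMA a b hab, b, ⟨hMB a b hab, ?_⟩, rfl⟩
        intro h
        obtain ⟨k, rfl⟩ := MulAction.mem_orbit_symm.1 h
        exact hq ⟨a, hMH.rankOne_smul_mem k.2 hab⟩
      · rw [← SetLike.mem_coe, hNe]
        rintro (h | h)
        · exact rankOne_notMem_reg _ _ h
        · exact (rankOne_mem_image2_iff.1 h).2.2 (MulAction.mem_orbit_self q)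
    · obtain ⟨N, hN, hNe⟩ := exists_definable_image2 hH
        (hA.inter (lineDefinable_orbit hH p).compl) hB
        (fun h hh b hb => ⟨hHA h hh b hb.1, smul_mem_compl_orbit hh hb.2⟩) hHB
        (hAB.mono_left Set.inter_subset_left)
      refine ⟨N, hN, ?_, ?_⟩
      · rw [← SetLike.coe_subset_coe, hNe]
        refine hMH.coe_subset (fun h => absurd h h0)
          fun a b hab => ⟨a, ⟨hMA a b hab, ?_⟩, b, hMB a b hab, rfl⟩
        intro h
        obtain ⟨k, rfl⟩ := MulAction.mem_orbit_symm.1 h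
        exact hp ⟨b, hMH.smul_rankOne_mem k.2 hab⟩
      · rw [← SetLike.mem_coe, hNe]
        rintro (h | h)
        · exact rankOne_notMem_reg _ _ h
        · exact (rankOne_mem_image2_iff.1 h).1.2 (MulAction.mem_orbit_self p)
  · obtain ⟨N, hN, hNe⟩ := exists_definable_image2 hH hA hB hHA hHB hAB
    refine ⟨N, hN, ?_, ?_⟩
    · rw [← SetLike.coe_subset_coe, hNe]
      exact hMH.coe_subset (fun h => absurd h h0)
        fun a b hab => ⟨a, hMA a b hab, b, hMB a b hab, rfl⟩
    · rw [← SetLike.mem_coe, hNe]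
      rintro (⟨h, hh, rfl⟩ | ⟨a, -, b, -, rfl⟩)
      · exact hx ((hMH.reg_mem_iff h).2 hh)
      · exact hxr ⟨a, b, rfl⟩

theorem isInterOfDefinableMonoids_of_finite_images (hMH : IsRegularPart M H)
    (hH : IsAlgebraicSubgroup H) (h0 : proj 0 ∉ M) (hfin : {a | ∃ b, rankOne a b ∈ M}.Finite) :
    IsInterOfDefinableMonoids M := by
  have hinv : ∀ h ∈ H, ∀ a ∈ {a | ∃ b, rankOne a b ∈ M}, h • a ∈ {a | ∃ b, rankOne a b ∈ M} :=
    fun h hh a ⟨b, hab⟩ => ⟨b, hMH.smul_rankOne_mem hh hab⟩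
  -- No kernel is an image, so the complement of the finite set of images encloses the kernels.
  refine isInterOfDefinableMonoids_of_disjoint hMH hH h0 hfin.lineDefinable
    hfin.lineDefinable.compl hinv (fun h hh a ha => smul_mem_compl hinv hh ha)
    disjoint_compl_right (fun a b hab => ⟨b, hab⟩) ?_
  rintro a b hab ⟨c, hbc⟩
  exact rankOne_ne_of_zero_notMem h0 hab hbc rfl

theorem isInterOfDefinableMonoids_of_finite_kernels (hMH : IsRegularPart M H)
    (hH : IsAlgebraicSubgroup H) (h0 : proj 0 ∉ M) (hfin : {b | ∃ a, rankOne a b ∈ M}.Finite) :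
    IsInterOfDefinableMonoids M := by
  have hinv : ∀ h ∈ H, ∀ b ∈ {b | ∃ a, rankOne a b ∈ M}, h • b ∈ {b | ∃ a, rankOne a b ∈ M} :=
    fun h hh b ⟨a, hab⟩ => ⟨a, hMH.rankOne_smul_mem hh hab⟩
  refine isInterOfDefinableMonoids_of_disjoint hMH hH h0 hfin.lineDefinable.compl
    hfin.lineDefinable (fun h hh a ha => smul_mem_compl hinv hh ha) hinv
    disjoint_compl_left ?_ (fun a b hab => ⟨a, hab⟩)
  rintro a b hab ⟨c, hca⟩
  exact rankOne_ne_of_zero_notMem h0 hca hab rfl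

/-! ### The ∞-definable case -/

/-- Unless some `Y i` is finite, all are cofinite, and fewer than 𝔠 finite sets have a union of size
less than 𝔠. -/
theorem finite_or_mk_compl_lt_continuum {ι : Type} {s : Set ι}
    (hs : #s < 𝔠) {Y : ι → Set (ℙ ℂ (Fin 2 → ℂ))} (hY : ∀ i ∈ s, LineDefinable (Y i)) :
    (⋂ i ∈ s, Y i).Finite ∨ #((⋂ i ∈ s, Y i)ᶜ : Set _) < 𝔠 := by
  by_cases h : ∃ i ∈ s, (Y i).Finite
  · obtain ⟨i, hi, hfin⟩ := h
    exact .inl (hfin.subset (Set.biInter_subset_of_mem hi))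
  · push Not at h
    right
    have hfin : ∀ i ∈ s, (Y i)ᶜ.Finite := fun i hi =>
      (hY i hi).finite_or_finite_compl.resolve_left (h i hi)
    rw [Set.compl_iInter₂]
    refine (Cardinal.mk_biUnion_le _ _).trans_lt (Cardinal.mul_lt_of_lt
      Cardinal.aleph0_le_continuum hs ?_)
    refine lt_of_le_of_lt (ciSup_le' fun i => ?_) Cardinal.aleph0_lt_continuum
    exact (hfin i i.2).lt_aleph0.le

theorem continuum_le_mk_projectivization : 𝔠 ≤ #(ℙ ℂ (Fin 2 → ℂ)) := by
  rw [← Cardinal.mk_complex]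
  refine Cardinal.mk_le_of_injective (f := fun z : ℂ => .mk ℂ ![z, 1]
    fun h => by simpa using congrFun h 1) fun z w h => ?_
  simpa [sub_eq_zero] using (cross_eq_zero_iff _ _).2 h

theorem finite_images_or_finite_kernels_of_infDefinable (h0 : proj 0 ∉ M)
    (hM : InfDefinable (M : Set PM2)) :
    {a | ∃ b, rankOne a b ∈ M}.Finite ∨ {b | ∃ a, rankOne a b ∈ M}.Finite := by
  obtain ⟨𝒟, hcard, hdef, hMD⟩ := hM
  by_cases hne : ∃ a b, rankOne a b ∈ M
  swap
  · left
    convert Set.finite_empty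
    exact Set.eq_empty_of_forall_notMem fun a ⟨b, hab⟩ => hne ⟨a, b, hab⟩
  obtain ⟨a₀, b₀, h₀⟩ := hne
  -- By the product structure the images form a section of M over the single kernel `b₀`, so no
  -- quantifier over `b` remains and the section commutes with the intersection.
  have hI : {a | ∃ b, rankOne a b ∈ M} = ⋂ D ∈ 𝒟, {a | rankOne a b₀ ∈ D} := by
    ext a
    have : rankOne a b₀ ∈ M ↔ ∀ D ∈ 𝒟, rankOne a b₀ ∈ D := by
      rw [← SetLike.mem_coe, hMD, Set.mem_sInter]
    simp only [Set.mem_iInter₂, Set.mem_ofPred_eq, ← this]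
    exact ⟨fun ⟨b, hab⟩ => rankOne_mem_of_zero_notMem h0 hab h₀, fun h => ⟨b₀, h⟩⟩
  have hK : {b | ∃ a, rankOne a b ∈ M} = ⋂ D ∈ 𝒟, {b | rankOne a₀ b ∈ D} := by
    ext b
    have : rankOne a₀ b ∈ M ↔ ∀ D ∈ 𝒟, rankOne a₀ b ∈ D := by
      rw [← SetLike.mem_coe, hMD, Set.mem_sInter]
    simp only [Set.mem_iInter₂, Set.mem_ofPred_eq, ← this]
    exact ⟨fun ⟨a, hab⟩ => rankOne_mem_of_zero_notMem h0 h₀ hab, fun h => ⟨a₀, h⟩⟩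
  by_contra! hinf
  have hI' := (finite_or_mk_compl_lt_continuum hcard
    fun D hD => (hdef D hD).setOf_rankOne_left b₀).resolve_left (hI ▸ hinf.1)
  have hK' := (finite_or_mk_compl_lt_continuum hcard
    fun D hD => (hdef D hD).setOf_rankOne_right a₀).resolve_left (hK ▸ hinf.2)
  rw [← hI] at hI'
  rw [← hK] at hK'
  have hU : ({a | ∃ b, rankOne a b ∈ M}ᶜ ∪ {b | ∃ a, rankOne a b ∈ M}ᶜ) = Set.univ := by
    rw [← Set.compl_inter, Set.compl_univ_iff]
    refine Set.eq_empty_of_forall_notMem ?_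
    rintro c ⟨⟨b, hcb⟩, a, hac⟩
    exact rankOne_ne_of_zero_notMem h0 hac hcb rfl
  have hlt := (Cardinal.mk_union_le _ _).trans_lt
    (Cardinal.add_lt_of_lt Cardinal.aleph0_le_continuum hI' hK')
  rw [hU, Cardinal.mk_univ] at hlt
  exact hlt.not_ge continuum_le_mk_projectivization

/-! ### Infinite regular part -/

theorem eq_one_of_smul_eq {k : PGL(2, ℂ)}
    (h0 : k • Projectivization.mk ℂ ![(1 : ℂ), 0] (by simp) = .mk ℂ ![1, 0] (by simp))
    (h1 : k • Projectivization.mk ℂ ![(0 : ℂ), 1] (by simp) = .mk ℂ ![0, 1] (by simp))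
    (h2 : k • Projectivization.mk ℂ ![(1 : ℂ), 1] (by simp) = .mk ℂ ![1, 1] (by simp)) :
    k = 1 := by
  induction k using Matrix.ProjGenLinGroup.induction_on with | mk g =>
  rw [Projectivization.PGL.mk_smul_mk, ← cross_eq_zero_iff] at h0 h1 h2
  replace h0 : (g.val.mulVec ![1, 0]) 1 = 0 := by simpa using h0
  replace h1 : (g.val.mulVec ![0, 1]) 0 = 0 := by simpa using h1
  replace h2 : (g.val.mulVec ![1, 1]) 0 = (g.val.mulVec ![1, 1]) 1 := by
    simpa [sub_eq_zero] using h2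
  simp only [Matrix.mulVec, dotProduct, Fin.sum_univ_two, Matrix.cons_val_zero,
    Matrix.cons_val_one, mul_one, mul_zero, add_zero, zero_add] at h0 h1 h2
  rw [h0, h1, add_zero, zero_add] at h2
  refine reg_injective ?_
  rw [map_one, reg_mk, ← map_one proj]
  have hne : g.val 0 0 ≠ 0 := by
    intro h
    apply g.det_ne_zero
    rw [Matrix.det_fin_two, h, h1]
    simp
  rw [← proj_smul hne 1]
  congr 1
  ext i j
  fin_cases i <;> fin_cases j <;> simp [h0, h1, h2]

theorem exists_infinite_orbit (hinf : (H : Set PGL(2, ℂ)).Infinite) :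
    ∃ a : ℙ ℂ (Fin 2 → ℂ), (MulAction.orbit H a).Infinite := by
  by_contra! hfin
  refine hinf ?_
  -- An element of PGL₂ is determined by its action on these three points, so finite orbits would
  -- make H finite.
  let x : Fin 3 → ℙ ℂ (Fin 2 → ℂ) :=
    ![.mk ℂ ![1, 0] (by simp), .mk ℂ ![0, 1] (by simp), .mk ℂ ![1, 1] (by simp)]
  refine Set.Finite.of_finite_image (f := fun h i => h • x i)
    ((Set.Finite.pi' fun i => hfin (x i)).subset ?_) ?_
  · rintro _ ⟨h, hh, rfl⟩ i
    exact ⟨⟨h, hh⟩, rfl⟩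
  · intro h _ k _ hhk
    have key : ∀ i, (k⁻¹ * h) • x i = x i := fun i => by
      rw [mul_smul, show h • x i = k • x i from congrFun hhk i, inv_smul_smul]
    exact (inv_mul_eq_one.1 (eq_one_of_smul_eq (key 0) (key 1) (key 2))).symm

theorem isDefinableMonoid_of_finite_compl_orbit (hMH : IsRegularPart M H)
    (hH : IsAlgebraicSubgroup H) {a : ℙ ℂ (Fin 2 → ℂ)} (ha : (MulAction.orbit H a)ᶜ.Finite) :
    IsDefinableMonoid M := by
  -- The point `a` represents its own orbit and the finitely many points outside it represent the
  -- others.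
  let F := insert a (MulAction.orbit H a)ᶜ
  have hF : F.Finite := ha.insert a
  have hrep : ∀ b, ∃ f ∈ F, b ∈ MulAction.orbit H f := fun b => by
    by_cases hb : b ∈ MulAction.orbit H a
    · exact ⟨a, Set.mem_insert _ _, hb⟩
    · exact ⟨b, Set.mem_insert_of_mem _ hb, MulAction.mem_orbit_self b⟩
  have hZ : Definable ({proj 0} ∩ M) := by
    by_cases h : proj 0 ∈ M
    · rw [Set.inter_eq_left.2 (Set.singleton_subset_iff.2 h)]
      exact definable_singleton_zero
    · rw [Set.singleton_inter_eq_empty.2 h]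
      exact definable_empty
  have hS := definable_biUnion (s := {p | p ∈ F ×ˢ F ∧ rankOne p.1 p.2 ∈ M})
    ((hF.prod hF).subset fun p hp => hp.1)
    fun p _ => (lineDefinable_orbit hH p.1).rankOne (lineDefinable_orbit hH p.2)
  have hM : (M : Set PM2) = reg '' H ∪ (({proj 0} ∩ M) ∪
      ⋃ p ∈ {p | p ∈ F ×ˢ F ∧ rankOne p.1 p.2 ∈ M},
        Set.image2 rankOne (MulAction.orbit H p.1) (MulAction.orbit H p.2)) := by
    refine Set.Subset.antisymm (hMH.coe_subset (fun h => .inl ⟨rfl, h⟩) fun b c hbc => .inr ?_) ?_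
    · obtain ⟨f, hf, h, rfl⟩ := hrep b
      obtain ⟨g, hg, k, rfl⟩ := hrep c
      refine Set.mem_biUnion (x := (f, g)) ⟨⟨hf, hg⟩, ?_⟩ ⟨_, ⟨h, rfl⟩, _, ⟨k, rfl⟩, rfl⟩
      have := hMH.smul_rankOne_mem (h⁻¹).2 (hMH.rankOne_smul_mem (k⁻¹).2 hbc)
      change rankOne (h⁻¹ • h • f) (k⁻¹ • k • g) ∈ M at this
      rwa [inv_smul_smul, inv_smul_smul] at this
    · rintro _ (⟨h, hh, rfl⟩ | h | hx)
      · exact (hMH.reg_mem_iff h).2 hh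
      · exact h.2
      · obtain ⟨p, ⟨-, hp⟩, _, ⟨h, rfl⟩, _, ⟨k, rfl⟩, rfl⟩ := Set.mem_iUnion₂.1 hx
        exact hMH.smul_rankOne_mem h.2 (hMH.rankOne_smul_mem k.2 hp)
  unfold IsDefinableMonoid
  rw [hM]
  exact (definable_regular hH).union (hZ.union hS)

theorem finite_or_finite_compl_of_smul_mem {a : ℙ ℂ (Fin 2 → ℂ)}
    (ha : (MulAction.orbit H a)ᶜ.Finite) {X : Set (ℙ ℂ (Fin 2 → ℂ))}
    (hX : ∀ h ∈ H, ∀ x ∈ X, h • x ∈ X) : X.Finite ∨ Xᶜ.Finite := by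
  by_cases haX : a ∈ X
  · right
    refine ha.subset (Set.compl_subset_compl.2 ?_)
    rintro _ ⟨h, rfl⟩
    exact hX h h.2 a haX
  · left
    refine ha.subset fun x hx hxa => haX ?_
    obtain ⟨h, rfl⟩ := MulAction.mem_orbit_symm.1 hxa
    exact hX h h.2 x hx

end PM2

theorem propositionP (M : Submonoid PM2) (H : Subgroup PGL(2, ℂ))
    (hMH : PM2.IsRegularPart M H) (hH : PM2.IsAlgebraicSubgroup H) :
    ((PM2.proj 0 ∈ M ∨ (PM2.imageLines M).Finite ∨ (PM2.kernelLines M).Finite ∨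
        PM2.InfDefinable (M : Set PM2)) →
      PM2.IsInterOfDefinableMonoids M) ∧
    ((H : Set PGL(2, ℂ)).Infinite →
      PM2.IsDefinableMonoid M ∧
      ∀ X : Set (ℙ ℂ (Fin 2 → ℂ)), (∀ h ∈ H, ∀ x ∈ X, h • x ∈ X) → X.Finite ∨ Xᶜ.Finite) := by
  refine ⟨fun h => ?_, fun hinf => ?_⟩
  · by_cases h0 : PM2.proj 0 ∈ M
    · exact PM2.isInterOfDefinableMonoids_of_zero_mem hMH hH h0
    have hfin : {a | ∃ b, PM2.rankOne a b ∈ M}.Finite ∨ {b | ∃ a, PM2.rankOne a b ∈ M}.Finite := by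
      obtain h | h | h | h := h
      · exact absurd h h0
      · exact .inl (PM2.finite_setOf_rankOne_mem_of_finite_imageLines h)
      · exact .inr (PM2.finite_setOf_rankOne_mem_of_finite_kernelLines h)
      · exact PM2.finite_images_or_finite_kernels_of_infDefinable h0 h
    exact hfin.elim (PM2.isInterOfDefinableMonoids_of_finite_images hMH hH h0)
      (PM2.isInterOfDefinableMonoids_of_finite_kernels hMH hH h0)
  · obtain ⟨a, ha⟩ := PM2.exists_infinite_orbit hinf
    have hc := (PM2.lineDefinable_orbit hH a).finite_or_finite_compl.resolve_left ha
    exact ⟨PM2.isDefinableMonoid_of_finite_compl_orbit hMH hH hc,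
      fun X hX => PM2.finite_or_finite_compl_of_smul_mem hc hX⟩
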